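/- Let $K$ be a field, let $H$ be a Hopf algebra over $K$, and let $\mathcal D$ be a right co-$H$-category, i.e. a small $K$-linear category in which each $\mathrm{Hom}_{\mathcal D}(X,Y)$ is a right $H$-comodule, with coaction $\rho(f)=\sum f_0\otimes f_1$, such that $\rho(\mathrm{id}_X)=\mathrm{id}_X\otimes 1_H$ and $\rho(f\circ g)=\sum (f_0\circ g_0)\otimes f_1g_1$ for all $g:X\to Y$ and $f:Y\to Z$. A relative $(\mathcal D,H)$-Hopf module is a $K$-linear functor $\mathcal M:\mathcal D\to \mathrm{Vect}_K$ together with a right $H$-comodule structure on each $\mathcal M(X)$ such that $\rho(\mathcal M(f)(m))=\sum \mathcal M(f_0)(m_0)\otimes f_1m_1$ for all $f\in\mathrm{Hom}_{\mathcal D}(X,Y)$ and $m\in\mathcal M(X)$. Let ${}_{\mathcal D}\mathscr M^H$ be the category whose objects are the relative $(\mathcal D,H)$-Hopf modules and whose morphisms are the natural transformations $\eta:\mathcal M\to\mathcal N$ such that every $\eta(X)$ is $K$-linear and $H$-colinear. For an object $X$ of $\mathcal D$ and a right $H$-comodule $W$, let ${}_X\mathbf h\otimes W$ be the relative $(\mathcal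 D,H)$-Hopf module $Y\mapsto \mathrm{Hom}_{\mathcal D}(X,Y)\otimes_K W$, on which a morphism $f$ of $\mathcal D$ acts by $g\otimes w\mapsto (f\circ g)\otimes w$, with coaction $\rho(g\otimes w)=\sum g_0\otimes w_0\otimes g_1w_1$. **Proposition.** The category ${}_{\mathcal D}\mathscr M^H$, with the pointwise addition of morphisms, is a Grothendieck abelian category (an abelian category with small colimits, exact filtered colimits and a generator). Moreover, the modules ${}_X\mathbf h\otimes W$, where $X$ ranges over the objects of $\mathcal D$ and $W$ over the finite-dimensional right $H$-comodules, form, up to isomorphism, a set, and they are a family of generators of ${}_{\mathcal D}\mathscr M^H$: two morphisms $u,v:\mathcal M\to\mathcal N$ that satisfy $u\circ t=v\circ t$ for every such $X$, $W$ and every morphism $t:{}_X\mathbf h\otimes W\to\mathcal M$ are equal. -/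

import Mathlib

open CategoryTheory Opposite
open scoped TensorProduct

universe u

/-- A right comodule over the coalgebra `H`: a coassociative and counital coaction
`ρ : M → M ⊗ H`. -/
class RightComodule (K H M : Type u) [Field K] [Ring H] [HopfAlgebra K H]
    [AddCommGroup M] [Module K M] where
  /-- the coaction -/
  ρ : M →ₗ[K] M ⊗[K] H
  coassoc : (TensorProduct.assoc K M H H).toLinearMap ∘ₗ ρ.rTensor H ∘ₗ ρ =
    (Coalgebra.comul (R := K) (A := H)).lTensor M ∘ₗ ρ
  counit : (Coalgebra.counit (R := K) (A := H)).lTensor M ∘ₗ ρ =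
    (TensorProduct.mk K M K).flip 1

/-- The pairing `(A ⊗ H) × (B ⊗ H) → C ⊗ H`, `(a ⊗ h, b ⊗ k) ↦ β a b ⊗ h k`, attached to a
bilinear map `β : A × B → C`. -/
noncomputable def pairH {K : Type u} (H : Type u) [Field K] [Ring H] [HopfAlgebra K H]
    {A B C : Type u} [AddCommGroup A] [Module K A] [AddCommGroup B] [Module K B]
    [AddCommGroup C] [Module K C] (β : A →ₗ[K] B →ₗ[K] C) :
    A ⊗[K] H →ₗ[K] B ⊗[K] H →ₗ[K] C ⊗[K] H :=
  TensorProduct.map₂ β (LinearMap.mul K H)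

section pairing

variable {K H : Type u} [Field K] [Ring H] [HopfAlgebra K H]
  {A B C : Type u} [AddCommGroup A] [Module K A] [AddCommGroup B] [Module K B]
  [AddCommGroup C] [Module K C]

@[simp]
theorem pairH_tmul (β : A →ₗ[K] B →ₗ[K] C) (a : A) (h : H) (b : B) (k : H) :
    pairH H β (a ⊗ₜ h) (b ⊗ₜ k) = β a b ⊗ₜ[K] (h * k) := rfl

theorem rTensor_pairH (β : A →ₗ[K] B →ₗ[K] C) (ρA : A →ₗ[K] A ⊗[K] H)
    (ρB : B →ₗ[K] B ⊗[K] H) (ρC : C →ₗ[K] C ⊗[K] H)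
    (hβ : ∀ a b, ρC (β a b) = pairH H β (ρA a) (ρB b)) (x : A ⊗[K] H) (y : B ⊗[K] H) :
    ρC.rTensor H (pairH H β x y) =
      pairH H (pairH H β) (ρA.rTensor H x) (ρB.rTensor H y) := by
  induction x with
  | zero => simp
  | add x x' hx hx' => simp only [map_add, LinearMap.add_apply, hx, hx']
  | tmul a h =>
    induction y with
    | zero => simp
    | add y y' hy hy' => simp only [map_add, hy, hy']
    | tmul b k => simp [hβ]

theorem assoc_pairH (β : A →ₗ[K] B →ₗ[K] C) (x : (A ⊗[K] H) ⊗[K] H)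
    (y : (B ⊗[K] H) ⊗[K] H) :
    TensorProduct.assoc K C H H (pairH H (pairH H β) x y) =
      TensorProduct.map₂ β (LinearMap.mul K (H ⊗[K] H))
        (TensorProduct.assoc K A H H x) (TensorProduct.assoc K B H H y) := by
  induction x with
  | zero => simp
  | add x x' hx hx' => simp only [map_add, LinearMap.add_apply, hx, hx']
  | tmul x h =>
    induction y with
    | zero => simp
    | add y y' hy hy' => simp only [map_add, hy, hy']
    | tmul y k =>
      induction x with
      | zero => simp
      | add x x' hx hx' =>
        simp only [map_add, LinearMap.add_apply, TensorProduct.add_tmul, hx, hx']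
      | tmul a h' =>
        induction y with
        | zero => simp
        | add y y' hy hy' => simp only [map_add, TensorProduct.add_tmul, hy, hy']
        | tmul b k' => simp

theorem lTensor_comul_pairH (β : A →ₗ[K] B →ₗ[K] C) (x : A ⊗[K] H) (y : B ⊗[K] H) :
    (Coalgebra.comul (R := K) (A := H)).lTensor C (pairH H β x y) =
      TensorProduct.map₂ β (LinearMap.mul K (H ⊗[K] H))
        ((Coalgebra.comul (R := K) (A := H)).lTensor A x)
        ((Coalgebra.comul (R := K) (A := H)).lTensor B y) := by
  induction x with
  | zero => simp
  | add x x' hx hx' => simp only [map_add, LinearMap.add_apply, hx, hx']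
  | tmul a h =>
    induction y with
    | zero => simp
    | add y y' hy hy' => simp only [map_add, hy, hy']
    | tmul b k => simp

theorem lTensor_counit_pairH (β : A →ₗ[K] B →ₗ[K] C) (x : A ⊗[K] H) (y : B ⊗[K] H) :
    (Coalgebra.counit (R := K) (A := H)).lTensor C (pairH H β x y) =
      TensorProduct.map₂ β (LinearMap.mul K K)
        ((Coalgebra.counit (R := K) (A := H)).lTensor A x)
        ((Coalgebra.counit (R := K) (A := H)).lTensor B y) := by
  induction x with
  | zero => simp
  | add x x' hx hx' => simp only [map_add, LinearMap.add_apply, hx, hx']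
  | tmul a h =>
    induction y with
    | zero => simp
    | add y y' hy hy' => simp only [map_add, hy, hy']
    | tmul b k => simp

/-- Associativity of the pairing. -/
theorem pairH_assoc {P Q R' S' : Type u} [AddCommGroup P] [Module K P] [AddCommGroup Q]
    [Module K Q] [AddCommGroup R'] [Module K R'] [AddCommGroup S'] [Module K S']
    (β : A →ₗ[K] B →ₗ[K] P) (γ : P →ₗ[K] Q →ₗ[K] R') (β' : B →ₗ[K] Q →ₗ[K] S')
    (γ' : A →ₗ[K] S' →ₗ[K] R') (e : ∀ a b q, γ (β a b) q = γ' a (β' b q))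
    (x : A ⊗[K] H) (y : B ⊗[K] H) (z : Q ⊗[K] H) :
    pairH H γ (pairH H β x y) z = pairH H γ' x (pairH H β' y z) := by
  induction x with
  | zero => simp
  | add x x' hx hx' => simp only [map_add, LinearMap.add_apply, hx, hx']
  | tmul a h =>
    induction y with
    | zero => simp
    | add y y' hy hy' => simp only [map_add, LinearMap.add_apply, hy, hy']
    | tmul b k =>
      induction z with
      | zero => simp
      | add z z' hz hz' => simp only [map_add, hz, hz']
      | tmul q l => simp [e, mul_assoc]

end pairing

/-- The tensor product of right comodules, with coaction
`m ⊗ n ↦ ∑ m₀ ⊗ n₀ ⊗ m₁ n₁`. -/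
noncomputable abbrev RightComodule.tensor (K H M N : Type u) [Field K] [Ring H]
    [HopfAlgebra K H] [AddCommGroup M] [Module K M] [AddCommGroup N] [Module K N]
    [RightComodule K H M] [RightComodule K H N] : RightComodule K H (M ⊗[K] N) where
  ρ := TensorProduct.lift
    ((pairH H (TensorProduct.mk K M N)).compl₁₂ RightComodule.ρ RightComodule.ρ)
  coassoc := by
    refine TensorProduct.ext' fun m n => ?_
    have hm := LinearMap.congr_fun (RightComodule.coassoc (K := K) (H := H) (M := M)) m
    have hn := LinearMap.congr_fun (RightComodule.coassoc (K := K) (H := H) (M := N)) n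
    simp only [LinearMap.comp_apply, LinearEquiv.coe_coe] at hm hn
    simp only [LinearMap.comp_apply, LinearEquiv.coe_coe, TensorProduct.lift.tmul,
      LinearMap.compl₁₂_apply]
    rw [rTensor_pairH (TensorProduct.mk K M N) RightComodule.ρ RightComodule.ρ _
      (fun a b => by simp), assoc_pairH, lTensor_comul_pairH, hm, hn]
  counit := by
    refine TensorProduct.ext' fun m n => ?_
    have hm := LinearMap.congr_fun (RightComodule.counit (K := K) (H := H) (M := M)) m
    have hn := LinearMap.congr_fun (RightComodule.counit (K := K) (H := H) (M := N)) n
    simp only [LinearMap.comp_apply] at hm hn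
    simp only [LinearMap.comp_apply, TensorProduct.lift.tmul, LinearMap.compl₁₂_apply]
    rw [lTensor_counit_pairH, hm, hn]
    simp

/-- A right co-`H`-category: a small `K`-linear category whose morphism spaces are right
`H`-comodules, such that `ρ(id) = id ⊗ 1` and, for `g : X ⟶ Y` and `f : Y ⟶ Z`,
`ρ(f ∘ g) = ∑ (f₀ ∘ g₀) ⊗ f₁ g₁`. -/
class CoHCategory (K H D : Type u) [Field K] [Ring H] [HopfAlgebra K H]
    [SmallCategory D] [Preadditive D] [Linear K D] where
  comod (X Y : D) : RightComodule K H (X ⟶ Y)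
  ρ_id (X : D) : (comod X X).ρ (𝟙 X) = 𝟙 X ⊗ₜ[K] (1 : H)
  ρ_comp {X Y Z : D} (g : X ⟶ Y) (f : Y ⟶ Z) :
    (comod X Z).ρ (g ≫ f) =
      pairH H (Linear.comp (S := K) X Y Z).flip ((comod Y Z).ρ f) ((comod X Y).ρ g)

attribute [reducible, instance] CoHCategory.comod

/-- For a left `D`-module `F` (a `K`-linear functor from `D` to `K`-vector spaces), the action
`(f, m) ↦ F(f)(m)` as a bilinear map. -/
def moduleAction {K D : Type u} [Field K] [SmallCategory D] [Preadditive D] [Linear K D]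
    (F : D ⥤ ModuleCat.{u} K) [F.Additive] [F.Linear K] (X Y : D) :
    (X ⟶ Y) →ₗ[K] F.obj X →ₗ[K] F.obj Y :=
  ModuleCat.homLinearEquiv.toLinearMap ∘ₗ F.mapLinearMap K

@[simp]
theorem moduleAction_apply {K D : Type u} [Field K] [SmallCategory D] [Preadditive D]
    [Linear K D] (F : D ⥤ ModuleCat.{u} K) [F.Additive] [F.Linear K] {X Y : D} (f : X ⟶ Y)
    (m : F.obj X) : moduleAction F X Y f m = (F.map f).hom m := rfl

/-- A relative `(D, H)`-Hopf module: a left `D`-module `F` with a right `H`-comodule structure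
on each `F(X)` such that `ρ(F(f)(m)) = ∑ F(f₀)(m₀) ⊗ f₁ m₁`. -/
structure RelHopfModule (K H D : Type u) [Field K] [Ring H] [HopfAlgebra K H]
    [SmallCategory D] [Preadditive D] [Linear K D] [CoHCategory K H D] where
  F : D ⥤ ModuleCat.{u} K
  additive : F.Additive
  linear : F.Linear K
  comod (X : D) : RightComodule K H (F.obj X)
  ρ_map {X Y : D} (f : X ⟶ Y) (m : F.obj X) :
    (comod Y).ρ ((F.map f).hom m) =
      pairH H (moduleAction F X Y) (RightComodule.ρ f) ((comod X).ρ m)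

namespace RelHopfModule

attribute [instance] RelHopfModule.additive RelHopfModule.linear RelHopfModule.comod

variable {K H D : Type u} [Field K] [Ring H] [HopfAlgebra K H]
  [SmallCategory D] [Preadditive D] [Linear K D] [CoHCategory K H D]

/-- A morphism of relative Hopf modules: a morphism of left `D`-modules all of whose components
are `H`-colinear. -/
@[ext]
structure Hom (M N : RelHopfModule K H D) where
  nat : M.F ⟶ N.F
  colinear (X : D) (m : M.F.obj X) :
    RightComodule.ρ (H := H) ((nat.app X).hom m) =
      (nat.app X).hom.rTensor H (RightComodule.ρ m)

/-- The category of relative `(D, H)`-Hopf modules. -/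
instance : Category (RelHopfModule K H D) where
  Hom := Hom
  id M := ⟨𝟙 M.F, fun X m => by simp⟩
  comp f g := ⟨f.nat ≫ g.nat, fun X m => by
    simp [f.colinear, g.colinear, LinearMap.rTensor_comp]⟩

@[simp] theorem id_nat (M : RelHopfModule K H D) : Hom.nat (𝟙 M) = 𝟙 M.F := rfl

@[simp] theorem comp_nat {M N P : RelHopfModule K H D} (f : M ⟶ N) (g : N ⟶ P) :
    (f ≫ g).nat = f.nat ≫ g.nat := rfl

@[ext]
theorem hom_ext {M N : RelHopfModule K H D} {f g : M ⟶ N} (h : f.nat = g.nat) : f = g :=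
  Hom.ext h

section additive

variable {M N : RelHopfModule K H D}

instance : Zero (M ⟶ N) := ⟨⟨0, fun X m => by simp⟩⟩

instance : Add (M ⟶ N) := ⟨fun f g => ⟨f.nat + g.nat, fun X m => by
  simp [f.colinear, g.colinear, LinearMap.rTensor_add]⟩⟩

instance : Neg (M ⟶ N) := ⟨fun f => ⟨-f.nat, fun X m => by
  simp [f.colinear, LinearMap.rTensor_neg]⟩⟩

instance : Sub (M ⟶ N) := ⟨fun f g => ⟨f.nat - g.nat, fun X m => by
  simp [f.colinear, g.colinear, LinearMap.rTensor_sub]⟩⟩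

instance : SMul ℕ (M ⟶ N) := ⟨fun n f => ⟨n • f.nat, fun X m => by
  simp only [NatTrans.app_nsmul, ModuleCat.hom_nsmul, LinearMap.smul_apply, map_nsmul, f.colinear]
  exact LinearMap.congr_fun (map_nsmul (LinearMap.rTensorHom H) n (f.nat.app X).hom).symm _⟩⟩

instance : SMul ℤ (M ⟶ N) := ⟨fun n f => ⟨n • f.nat, fun X m => by
  simp only [NatTrans.app_zsmul, ModuleCat.hom_zsmul, LinearMap.smul_apply, map_zsmul, f.colinear]
  exact LinearMap.congr_fun (map_zsmul (LinearMap.rTensorHom H) n (f.nat.app X).hom).symm _⟩⟩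

instance : AddCommGroup (M ⟶ N) :=
  Function.Injective.addCommGroup (fun f : M ⟶ N => f.nat) (fun _ _ h => hom_ext h)
    rfl (fun _ _ => rfl) (fun _ => rfl) (fun _ _ => rfl) (fun _ _ => rfl) (fun _ _ => rfl)

@[simp] theorem add_nat (f g : M ⟶ N) : (f + g).nat = f.nat + g.nat := rfl

end additive

/-- The category of relative Hopf modules is preadditive, with pointwise addition. -/
instance instPreadditive : Preadditive (RelHopfModule K H D) where
  add_comp _ _ _ _ _ _ := by ext1; simp
  comp_add _ _ _ _ _ _ := by ext1; simp

/-- The relative Hopf module `Hom_D(X, -)`. -/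
def representable (K H : Type u) {D : Type u} [Field K] [Ring H] [HopfAlgebra K H]
    [SmallCategory D] [Preadditive D] [Linear K D] [CoHCategory K H D] (X : D) :
    RelHopfModule K H D where
  F :=
    { obj := fun Y => ModuleCat.of K (X ⟶ Y)
      map := fun f => ModuleCat.ofHom (Linear.rightComp K X f)
      map_id := fun Y => by ext; simp
      map_comp := fun f g => by ext; simp }
  additive := ⟨by intros; ext; simp⟩
  linear := ⟨by intros; ext; simp⟩
  comod Y := CoHCategory.comod X Y
  ρ_map f m := CoHCategory.ρ_comp m f

/-- The left `D`-module `F ⊗ W`, `X ↦ F(X) ⊗ W`, for a left `D`-module `F` and a vector space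
`W`. -/
noncomputable def tensorFunctor (F : D ⥤ ModuleCat.{u} K) (W : Type u) [AddCommGroup W]
    [Module K W] : D ⥤ ModuleCat.{u} K where
  obj Y := ModuleCat.of K (F.obj Y ⊗[K] W)
  map f := ModuleCat.ofHom ((F.map f).hom.rTensor W)
  map_id Y := by ext : 1; simp
  map_comp f g := by ext : 1; simp [LinearMap.rTensor_comp]

instance (F : D ⥤ ModuleCat.{u} K) [F.Additive] (W : Type u) [AddCommGroup W] [Module K W] :
    (tensorFunctor F W).Additive :=
  ⟨fun {_ _ f g} => ModuleCat.hom_ext <| by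
    change (F.map (f + g)).hom.rTensor W = (F.map f).hom.rTensor W + (F.map g).hom.rTensor W
    simp [LinearMap.rTensor_add]⟩

instance (F : D ⥤ ModuleCat.{u} K) [F.Linear K] (W : Type u) [AddCommGroup W] [Module K W] :
    (tensorFunctor F W).Linear K :=
  ⟨fun f r => ModuleCat.hom_ext <| by
    change (F.map (r • f)).hom.rTensor W = r • (F.map f).hom.rTensor W
    simp [LinearMap.rTensor_smul]⟩

theorem tensor_ρ_map (N : RelHopfModule K H D) (W : Type u) [AddCommGroup W] [Module K W]
    [RightComodule K H W] {X Y : D} (f : X ⟶ Y) (m : N.F.obj X ⊗[K] W) :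
    (RightComodule.tensor K H (N.F.obj Y) W).ρ ((N.F.map f).hom.rTensor W m) =
      pairH H (LinearMap.rTensorHom W ∘ₗ moduleAction N.F X Y)
        (RightComodule.ρ f) ((RightComodule.tensor K H (N.F.obj X) W).ρ m) := by
  induction m using TensorProduct.induction_on with
  | zero => simp only [map_zero]
  | add m m' hm hm' => simp only [map_add, hm, hm']
  | tmul n w =>
    change pairH H (TensorProduct.mk K (N.F.obj Y) W)
        (RightComodule.ρ ((N.F.map f).hom n)) (RightComodule.ρ w) =
      pairH H _ (RightComodule.ρ f)
        (pairH H (TensorProduct.mk K (N.F.obj X) W) (RightComodule.ρ n) (RightComodule.ρ w))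
    rw [N.ρ_map]
    exact pairH_assoc _ _ _ _ (fun _ _ _ => rfl) _ _ _

/-- The relative Hopf module `N ⊗ W`, `X ↦ N(X) ⊗ W`, for a relative Hopf module `N` and a right
comodule `W`. -/
noncomputable def tensor (N : RelHopfModule K H D) (W : Type u) [AddCommGroup W] [Module K W]
    [RightComodule K H W] : RelHopfModule K H D where
  F := tensorFunctor N.F W
  additive := inferInstance
  linear := inferInstance
  comod Y := RightComodule.tensor K H (N.F.obj Y) W
  ρ_map f m := tensor_ρ_map N W f m

/-- The property of being one of the modules `Hom_D(X, -) ⊗ W`, with `X` an object of `D` and `W`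
a finite-dimensional right `H`-comodule. -/
inductive IsStandardGenerator : ObjectProperty (RelHopfModule K H D)
  | mk (X : D) (W : Type u) [AddCommGroup W] [Module K W] [FiniteDimensional K W]
      [RightComodule K H W] : IsStandardGenerator ((representable K H X).tensor W)

end RelHopfModule

/-! Everything is transported along the functor `forget` to the category of all functors from `D` to
vector spaces, which is abelian with exact filtered colimits. This functor creates colimits and
finite limits. On a colimit the universal property supplies the coaction; on a finite limit it
exists because `- ⊗ H` is exact over a field. The comodule axioms, the linearity of the functor and
the Hopf compatibility are then equations that can be tested on the jointly epimorphic legs, or on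
the jointly injective projections. As `forget` is also faithful and reflects isomorphisms, the
coimage-image comparison is invertible and filtered colimits are exact.

For the generators, a colinear map `φ : W → M(X)` gives by Yoneda a morphism `Hom_D(X, -) ⊗ W ⟶ M`
sending `𝟙 X ⊗ w` to `φ w` (`ofColinear`). Every element of `M(X)` lies in a finite-dimensional
subcomodule (`exists_finiteDimensional_subcomodule`), so it is hit by such a morphism. In
coordinates `W` becomes some `Kⁿ`, and this leaves only a set of modules; their coproduct is a
generator. -/

/-! ### Naturality of the pairing -/

section pairing

variable {K H : Type u} [Field K] [Ring H] [HopfAlgebra K H]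
  {A B B' C : Type u} [AddCommGroup A] [Module K A] [AddCommGroup B] [Module K B]
  [AddCommGroup B'] [Module K B'] [AddCommGroup C] [Module K C]

/-- Makes `TensorProduct.lift β` colinear for the tensor coaction once `β` respects the coactions.
-/
theorem rTensor_lift_pairH_mk (β : A →ₗ[K] B →ₗ[K] C) (x : A ⊗[K] H) (y : B ⊗[K] H) :
    (TensorProduct.lift β).rTensor H (pairH H (TensorProduct.mk K A B) x y) = pairH H β x y := by
  induction x with
  | zero => simp
  | add x x' hx hx' => simp only [map_add, LinearMap.add_apply, hx, hx']
  | tmul a h =>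
    induction y with
    | zero => simp
    | add y y' hy hy' => simp only [map_add, hy, hy']
    | tmul b k => simp

theorem pairH_compl₂ (β : A →ₗ[K] B →ₗ[K] C) (φ : B' →ₗ[K] B) (x : A ⊗[K] H)
    (y : B' ⊗[K] H) : pairH H (β.compl₂ φ) x y = pairH H β x (φ.rTensor H y) := by
  induction x with
  | zero => simp
  | add x x' hx hx' => simp only [map_add, LinearMap.add_apply, hx, hx']
  | tmul a h =>
    induction y with
    | zero => simp
    | add y y' hy hy' => simp only [map_add, hy, hy']
    | tmul b k => simp

/-- With `φ` the identity, this carries the Hopf compatibility along a colinear natural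
transformation. -/
theorem rTensor_pairH_of_comp {A' B'' C' : Type u} [AddCommGroup A'] [Module K A']
    [AddCommGroup B''] [Module K B''] [AddCommGroup C'] [Module K C']
    (β : A →ₗ[K] B →ₗ[K] C) (β' : A' →ₗ[K] B'' →ₗ[K] C')
    (φ : A →ₗ[K] A') (ψ : B →ₗ[K] B'') (χ : C →ₗ[K] C')
    (e : ∀ a b, χ (β a b) = β' (φ a) (ψ b)) (x : A ⊗[K] H) (y : B ⊗[K] H) :
    χ.rTensor H (pairH H β x y) = pairH H β' (φ.rTensor H x) (ψ.rTensor H y) := by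
  induction x with
  | zero => simp
  | add x x' hx hx' => simp only [map_add, LinearMap.add_apply, hx, hx']
  | tmul a h =>
    induction y with
    | zero => simp
    | add y y' hy hy' => simp only [map_add, hy, hy']
    | tmul b k => simp [e]

end pairing

/-! ### Transport of comodule structures -/

namespace RightComodule

variable {K H : Type u} [Field K] [Ring H] [HopfAlgebra K H]
  {M N : Type u} [AddCommGroup M] [Module K M] [AddCommGroup N] [Module K N]

theorem coassoc_apply [RightComodule K H M] (m : M) :
    TensorProduct.assoc K M H H ((ρ (K := K) (H := H) (M := M)).rTensor H (ρ m)) =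
      (Coalgebra.comul (R := K) (A := H)).lTensor M (ρ m) :=
  LinearMap.congr_fun (coassoc (K := K) (H := H) (M := M)) m

theorem counit_apply [RightComodule K H M] (m : M) :
    (Coalgebra.counit (R := K) (A := H)).lTensor M (ρ m) = m ⊗ₜ[K] (1 : K) :=
  LinearMap.congr_fun (counit (K := K) (H := H) (M := M)) m

/-- Colinear maps intertwine the left-hand sides of coassociativity. -/
theorem rTensor_assoc_rTensor (φ : N →ₗ[K] M) (σ : N →ₗ[K] N ⊗[K] H) (τ : M →ₗ[K] M ⊗[K] H)
    (h : φ.rTensor H ∘ₗ σ = τ ∘ₗ φ) (x : N ⊗[K] H) :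
    φ.rTensor (H ⊗[K] H) (TensorProduct.assoc K N H H (σ.rTensor H x)) =
      TensorProduct.assoc K M H H (τ.rTensor H (φ.rTensor H x)) := by
  have key : ∀ (y : N ⊗[K] H) (k : H), φ.rTensor (H ⊗[K] H) (TensorProduct.assoc K N H H (y ⊗ₜ k)) =
      TensorProduct.assoc K M H H (φ.rTensor H y ⊗ₜ k) := by
    intro y k
    induction y with
    | zero => simp
    | add y y' hy hy' => simp only [map_add, TensorProduct.add_tmul, hy, hy']
    | tmul n l => simp
  induction x with
  | zero => simp
  | add x x' hx hx' => simp only [map_add, hx, hx']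
  | tmul n k =>
    have := LinearMap.congr_fun h n
    simp only [LinearMap.comp_apply] at this
    simp [key, this]

theorem rTensor_lTensor {L L' : Type u} [AddCommGroup L] [Module K L] [AddCommGroup L']
    [Module K L'] (φ : N →ₗ[K] M) (ψ : L →ₗ[K] L') (x : N ⊗[K] L) :
    φ.rTensor L' (ψ.lTensor N x) = ψ.lTensor M (φ.rTensor L x) := by
  rw [← LinearMap.comp_apply, ← LinearMap.comp_apply, LinearMap.rTensor_comp_lTensor,
    LinearMap.lTensor_comp_rTensor]

/-- A map `σ : N → N ⊗ H` is a comodule structure if a family of linear maps from `N` to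
comodules, which are compatible with the coactions, is jointly injective after tensoring with any
vector space. -/
abbrev ofJointlyInjective {ι : Type*} {M : ι → Type u} [∀ i, AddCommGroup (M i)]
    [∀ i, Module K (M i)] [∀ i, RightComodule K H (M i)] (φ : ∀ i, N →ₗ[K] M i)
    (hφ : ∀ (L : Type u) [AddCommGroup L] [Module K L] (x y : N ⊗[K] L),
      (∀ i, (φ i).rTensor L x = (φ i).rTensor L y) → x = y)
    (σ : N →ₗ[K] N ⊗[K] H) (hσ : ∀ i, (φ i).rTensor H ∘ₗ σ = ρ ∘ₗ φ i) :
    RightComodule K H N where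
  ρ := σ
  coassoc := by
    ext n
    -- After `φ i` is applied, both sides become those of the axiom for the comodule `M i`.
    refine hφ _ _ _ fun i => ?_
    have := LinearMap.congr_fun (hσ i) n
    simp only [LinearMap.comp_apply] at this
    simp only [LinearMap.comp_apply, LinearEquiv.coe_coe]
    rw [rTensor_assoc_rTensor (φ i) σ ρ (hσ i), rTensor_lTensor, this, coassoc_apply]
  counit := by
    ext n
    refine hφ _ _ _ fun i => ?_
    have := LinearMap.congr_fun (hσ i) n
    simp only [LinearMap.comp_apply] at this
    simp only [LinearMap.comp_apply]
    rw [rTensor_lTensor, this, counit_apply]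
    simp

/-- A map `σ : N → N ⊗ H` is a comodule structure if a family of linear maps from comodules to
`N`, which are compatible with the coactions, is jointly epimorphic. -/
abbrev ofJointlyEpi {ι : Type*} {M : ι → Type u} [∀ i, AddCommGroup (M i)]
    [∀ i, Module K (M i)] [∀ i, RightComodule K H (M i)] (φ : ∀ i, M i →ₗ[K] N)
    (hφ : ∀ (L : Type u) [AddCommGroup L] [Module K L] (f g : N →ₗ[K] L),
      (∀ i, f ∘ₗ φ i = g ∘ₗ φ i) → f = g)
    (σ : N →ₗ[K] N ⊗[K] H) (hσ : ∀ i, (φ i).rTensor H ∘ₗ ρ = σ ∘ₗ φ i) :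
    RightComodule K H N where
  ρ := σ
  coassoc := by
    refine hφ _ _ _ fun i => LinearMap.ext fun m => ?_
    have := LinearMap.congr_fun (hσ i) m
    simp only [LinearMap.comp_apply] at this
    simp only [LinearMap.comp_apply, LinearEquiv.coe_coe]
    rw [← this, ← rTensor_assoc_rTensor (φ i) ρ σ (hσ i), coassoc_apply, rTensor_lTensor]
  counit := by
    refine hφ _ _ _ fun i => LinearMap.ext fun m => ?_
    have := LinearMap.congr_fun (hσ i) m
    simp only [LinearMap.comp_apply] at this
    simp only [LinearMap.comp_apply]
    rw [← this, ← rTensor_lTensor, counit_apply]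
    simp

/-- The comodule structure on the source of an injective map to a comodule. -/
abbrev ofInjective [RightComodule K H M] (φ : N →ₗ[K] M) (hφ : Function.Injective φ)
    (σ : N →ₗ[K] N ⊗[K] H) (hσ : φ.rTensor H ∘ₗ σ = ρ ∘ₗ φ) : RightComodule K H N :=
  ofJointlyInjective (fun _ : Unit => φ)
    -- Every vector space is flat, so one injective map is already a jointly injective family.
    (fun L _ _ _ _ h => Module.Flat.rTensor_preserves_injective_linearMap (M := L) φ hφ (h ()))
    σ (fun _ => hσ)

/-- A subspace whose image under the coaction is contained in its tensor product with `H` is a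
comodule. -/
theorem exists_submodule_comodule [RightComodule K H M] (P : Submodule K M)
    (hP : ∀ x ∈ P, ρ (H := H) x ∈ LinearMap.range (P.subtype.rTensor H)) :
    ∃ _ : RightComodule K H P, ∀ x : P,
      ρ (H := H) (x : M) = P.subtype.rTensor H (ρ x) := by
  have inj : Function.Injective (P.subtype.rTensor H) :=
    Module.Flat.rTensor_preserves_injective_linearMap (M := H) _ P.injective_subtype
  let e := LinearEquiv.ofInjective (P.subtype.rTensor H) inj
  -- `P ⊗ H` is identified with its image in `M ⊗ H`, where `ρ` takes its values on `P`.
  let σ : P →ₗ[K] P ⊗[K] H := e.symm.toLinearMap ∘ₗ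
    (ρ ∘ₗ P.subtype).codRestrict (LinearMap.range (P.subtype.rTensor H)) fun x => hP x x.2
  have hσ : P.subtype.rTensor H ∘ₗ σ = ρ ∘ₗ P.subtype := by
    ext x
    have := congrArg Subtype.val (e.apply_symm_apply ⟨ρ (x : M), hP x x.2⟩)
    exact this
  exact ⟨ofInjective P.subtype P.injective_subtype σ hσ,
    fun x => (LinearMap.congr_fun hσ x).symm⟩

/-! ### Local finiteness of comodules -/

theorem ρ_rid_lTensor [RightComodule K H M] (φ : H →ₗ[K] K) (x : M ⊗[K] H) :
    ρ (H := H) (TensorProduct.rid K M (φ.lTensor M x)) =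
      TensorProduct.rid K (M ⊗[K] H) (φ.lTensor (M ⊗[K] H) ((ρ (M := M)).rTensor H x)) := by
  induction x with
  | zero => simp
  | add x x' hx hx' => simp only [map_add, hx, hx']
  | tmul m h => simp

/-- Together with `ρ_rid_lTensor`, this computes the coaction on a coefficient of `ρ m`: contract
the last factor of the coassociativity identity with `φ`. -/
theorem rid_lTensor_assoc_symm (φ : H →ₗ[K] K) (m : M) (t : H ⊗[K] H) :
    TensorProduct.rid K (M ⊗[K] H)
      (φ.lTensor (M ⊗[K] H) ((TensorProduct.assoc K M H H).symm (m ⊗ₜ t))) =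
      m ⊗ₜ TensorProduct.rid K H (φ.lTensor H t) := by
  induction t with
  | zero => simp
  | add x x' hx hx' => simp only [map_add, TensorProduct.tmul_add, hx, hx']
  | tmul h k => simp

/-- Every element of a comodule lies in a finite-dimensional subcomodule. -/
theorem exists_finiteDimensional_subcomodule [RightComodule K H M] (m : M) :
    ∃ P : Submodule K M, m ∈ P ∧ FiniteDimensional K P ∧
      ∃ _ : RightComodule K H P, ∀ x : P,
        ρ (H := H) (x : M) = P.subtype.rTensor H (ρ x) := by
  classical
  let b := Module.Basis.ofVectorSpace K H
  let v := TensorProduct.equivFinsuppOfBasisRight b (ρ (K := K) (H := H) m)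
  have hv : ρ (K := K) (H := H) m = v.sum fun i x => x ⊗ₜ b i := by
    rw [← TensorProduct.equivFinsuppOfBasisRight_symm_apply b, LinearEquiv.symm_apply_apply]
  -- Write `ρ m = ∑ vᵢ ⊗ bᵢ`; the finitely many nonzero coefficients `vᵢ` span the subcomodule.
  let P := Submodule.span K (v '' v.support)
  have hvP : ∀ i, v i ∈ P := fun i => by
    by_cases hi : i ∈ v.support
    · exact Submodule.subset_span ⟨i, hi, rfl⟩
    · rw [Finsupp.notMem_support_iff.1 hi]
      exact P.zero_mem
  refine ⟨P, ?_, FiniteDimensional.span_of_finite K (v.support.finite_toSet.image _),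
    exists_submodule_comodule P fun x hx => ?_⟩
  -- The counit axiom reads `m = ∑ ε(bᵢ) vᵢ`.
  · have h := congrArg (TensorProduct.rid K M) (counit_apply (H := H) (K := K) m)
    rw [hv, Finsupp.sum, map_sum, map_sum, TensorProduct.rid_tmul, one_smul] at h
    rw [← h]
    refine P.sum_mem fun i _ => ?_
    simpa using P.smul_mem _ (hvP i)
  · revert x
    refine Submodule.span_le (p := (LinearMap.range (P.subtype.rTensor H)).comap ρ).2 ?_
    rintro _ ⟨i, -, rfl⟩
    have h := coassoc_apply (K := K) (H := H) m
    rw [← LinearEquiv.eq_symm_apply] at h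
    simp only [Submodule.comap_coe, Set.mem_preimage, SetLike.mem_coe]
    -- With `bᵢ*` the coordinate functional, `vᵢ = (id ⊗ bᵢ*)(ρ m)`, so coassociativity gives `ρ vᵢ
    -- = ∑ⱼ vⱼ ⊗ (id ⊗ bᵢ*)(Δ bⱼ)`, which lies in `P ⊗ H`.
    rw [TensorProduct.equivFinsuppOfBasisRight_apply, ρ_rid_lTensor, h, hv, Finsupp.sum]
    simp only [map_sum]
    refine Submodule.sum_mem _ fun j _ => ?_
    rw [LinearMap.lTensor_tmul, rid_lTensor_assoc_symm]
    exact ⟨(⟨v j, hvP j⟩ : P) ⊗ₜ _, LinearMap.rTensor_tmul _ _ _ _⟩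

end RightComodule

/-! ### Coactions on colimits and finite limits of vector spaces -/

namespace RightComodule

open Limits MonoidalCategory

variable {K H : Type u} [Field K] [Ring H] [HopfAlgebra K H]

section composition

variable {L M N : Type u} [AddCommGroup L] [Module K L] [AddCommGroup M] [Module K M]
  [AddCommGroup N] [Module K N] [RightComodule K H L] [RightComodule K H M] [RightComodule K H N]

/-- When `a` runs over the legs of a colimit, this shows that the induced map `b` is colinear. -/
theorem ρ_comp_of_colinear {a : L →ₗ[K] M} {b : M →ₗ[K] N} {g : L →ₗ[K] N} (hg : b ∘ₗ a = g)
    (ha' : a.rTensor H ∘ₗ ρ = ρ ∘ₗ a) (hg' : g.rTensor H ∘ₗ ρ = ρ ∘ₗ g) :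
    (ρ ∘ₗ b) ∘ₗ a = (b.rTensor H ∘ₗ ρ) ∘ₗ a := by
  rw [LinearMap.comp_assoc, LinearMap.comp_assoc, hg, ← hg', ← ha', ← hg, LinearMap.rTensor_comp,
    LinearMap.comp_assoc]

/-- The dual criterion: when `b` runs over the projections of a limit, the induced map `a` is
colinear. -/
theorem rTensor_comp_of_colinear {a : L →ₗ[K] M} {b : M →ₗ[K] N} {g : L →ₗ[K] N}
    (hg : b ∘ₗ a = g) (hb' : b.rTensor H ∘ₗ ρ = ρ ∘ₗ b) (hg' : g.rTensor H ∘ₗ ρ = ρ ∘ₗ g) (x : L) :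
    b.rTensor H (ρ (a x)) = b.rTensor H (a.rTensor H (ρ x)) := by
  simp only [← LinearMap.comp_apply]
  rw [← LinearMap.comp_assoc, hb', ← LinearMap.comp_assoc, ← LinearMap.rTensor_comp, hg, hg',
    LinearMap.comp_assoc, hg]

end composition

section colimits

variable {J : Type*} [Category* J] {G : J ⥤ ModuleCat.{u} K}

/-- The legs of a cocone of vector spaces as linear maps. -/
def leg (c : Cocone G) (j : J) : G.obj j →ₗ[K] c.pt := (c.ι.app j).hom

theorem linearMap_ext_of_isColimit {c : Cocone G} (hc : IsColimit c) {L : Type u}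
    [AddCommGroup L] [Module K L] {f g : c.pt →ₗ[K] L}
    (h : ∀ j, f ∘ₗ leg c j = g ∘ₗ leg c j) : f = g :=
  congrArg ModuleCat.Hom.hom (hc.hom_ext (f := ModuleCat.ofHom f) (f' := ModuleCat.ofHom g)
    fun j => ModuleCat.hom_ext (h j))

theorem exists_comodule_of_isColimit {c : Cocone G} (hc : IsColimit c)
    [∀ j, RightComodule K H (G.obj j)]
    (hG : ∀ {i j : J} (f : i ⟶ j), (G.map f).hom.rTensor H ∘ₗ ρ = ρ ∘ₗ (G.map f).hom) :
    ∃ _ : RightComodule K H c.pt, ∀ j, (leg c j).rTensor H ∘ₗ ρ = ρ ∘ₗ leg c j := by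
  -- The coaction will be the map induced by this cocone; `- ⊗ H` need not be known to preserve the
  -- colimit.
  let s : Cocone G :=
    { pt := ModuleCat.of K (c.pt ⊗[K] H)
      ι :=
        { app j := ModuleCat.ofHom ((leg c j).rTensor H ∘ₗ ρ)
          naturality i j f := by
            ext1
            change ((leg c j).rTensor H ∘ₗ ρ) ∘ₗ (G.map f).hom = (leg c i).rTensor H ∘ₗ ρ
            rw [LinearMap.comp_assoc, ← hG, ← LinearMap.comp_assoc, ← LinearMap.rTensor_comp,
              leg, ← ModuleCat.hom_comp, c.w]
            rfl } }
  have hs (j : J) : (hc.desc s).hom ∘ₗ leg c j = (leg c j).rTensor H ∘ₗ ρ :=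
    congrArg ModuleCat.Hom.hom (hc.fac s j)
  exact ⟨ofJointlyEpi (leg c) (fun L _ _ f g h => linearMap_ext_of_isColimit hc h)
    (hc.desc s).hom fun j => (hs j).symm, fun j => (hs j).symm⟩

end colimits

section limits

variable {J : Type} [SmallCategory J] [FinCategory J] {G : J ⥤ ModuleCat.{u} K}

/-- The projections of a cone of vector spaces as linear maps. -/
def proj (c : Cone G) (j : J) : c.pt →ₗ[K] G.obj j := (c.π.app j).hom

/-- Tensoring with `L` is exact over a field, hence preserves finite limits; this is where
finiteness of `J` enters. -/
theorem tensor_ext_of_isLimit {c : Cone G} (hc : IsLimit c) (L : Type u) [AddCommGroup L]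
    [Module K L] {x y : c.pt ⊗[K] L}
    (h : ∀ j, (proj c j).rTensor L x = (proj c j).rTensor L y) : x = y :=
  Concrete.isLimit_ext _ (isLimitOfPreserves (tensorRight (ModuleCat.of K L)) hc) x y h

theorem exists_comodule_of_isLimit {c : Cone G} (hc : IsLimit c)
    [∀ j, RightComodule K H (G.obj j)]
    (hG : ∀ {i j : J} (f : i ⟶ j), (G.map f).hom.rTensor H ∘ₗ ρ = ρ ∘ₗ (G.map f).hom) :
    ∃ _ : RightComodule K H c.pt, ∀ j, (proj c j).rTensor H ∘ₗ ρ = ρ ∘ₗ proj c j := by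
  let T := tensorRight (ModuleCat.of K H)
  let s : Cone (G ⋙ T) :=
    { pt := c.pt
      π :=
        { app j := ModuleCat.ofHom (ρ ∘ₗ proj c j)
          naturality i j f := by
            ext1
            change ρ ∘ₗ proj c j = (G.map f).hom.rTensor H ∘ₗ ρ ∘ₗ proj c i
            rw [← LinearMap.comp_assoc, hG, LinearMap.comp_assoc, proj, proj,
              ← ModuleCat.hom_comp, c.w] } }
  have hL := isLimitOfPreserves T hc
  have hs (j : J) : (proj c j).rTensor H ∘ₗ (hL.lift s).hom = ρ ∘ₗ proj c j :=
    congrArg ModuleCat.Hom.hom (hL.fac s j)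
  exact ⟨ofJointlyInjective (proj c) (fun L _ _ x y h => tensor_ext_of_isLimit hc L h)
    (hL.lift s).hom hs, hs⟩

end limits

end RightComodule

/-! ### The forgetful functor creates colimits and finite limits -/

namespace RelHopfModule

open Limits

variable {K H D : Type u} [Field K] [Ring H] [HopfAlgebra K H]
  [SmallCategory D] [Preadditive D] [Linear K D] [CoHCategory K H D]

variable (K H D) in
/-- The functor that forgets the coactions. -/
@[simps]
def forget : RelHopfModule K H D ⥤ D ⥤ ModuleCat.{u} K where
  obj M := M.F
  map f := f.nat

instance : (forget K H D).Faithful := ⟨fun h => hom_ext h⟩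

instance : (forget K H D).Additive where

instance : (forget K H D).ReflectsIsomorphisms where
  reflects {M N} f hf := by
    change IsIso f.nat at hf
    refine ⟨⟨⟨inv f.nat, fun X n => ?_⟩, ?_, ?_⟩⟩
    · have h₁ : ((inv f.nat).app X).hom ∘ₗ (f.nat.app X).hom = LinearMap.id := by
        rw [← ModuleCat.hom_comp, ← NatTrans.comp_app, IsIso.hom_inv_id]; rfl
      have h₂ : (f.nat.app X).hom ∘ₗ ((inv f.nat).app X).hom = LinearMap.id := by
        rw [← ModuleCat.hom_comp, ← NatTrans.comp_app, IsIso.inv_hom_id]; rfl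
      -- Write `n` as `f (f⁻¹ n)` and move `ρ` past `f`; then `f⁻¹ ⊗ H` cancels `f ⊗ H`.
      conv_rhs => rw [← LinearMap.id_apply (R := K) n, ← h₂, LinearMap.comp_apply, f.colinear,
        ← LinearMap.comp_apply, ← LinearMap.rTensor_comp, h₁, LinearMap.rTensor_id]
      rfl
    · ext1; simp
    · ext1; simp

theorem rTensor_comp_ρ {M N : RelHopfModule K H D} (f : M ⟶ N) (X : D) :
    (f.nat.app X).hom.rTensor H ∘ₗ RightComodule.ρ = RightComodule.ρ ∘ₗ (f.nat.app X).hom :=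
  LinearMap.ext fun m => (f.colinear X m).symm

section

variable {ι : Type*} (N : ι → RelHopfModule K H D) (F : D ⥤ ModuleCat.{u} K)
  [∀ X, RightComodule K H (F.obj X)]

/-- A functor with coactions which receives a jointly epimorphic family of colinear natural
transformations from relative Hopf modules is a relative Hopf module. -/
abbrev ofJointlyEpi (t : ∀ i, (N i).F ⟶ F)
    (ht : ∀ i X, ((t i).app X).hom.rTensor H ∘ₗ RightComodule.ρ =
      RightComodule.ρ ∘ₗ ((t i).app X).hom)
    (h : ∀ (X : D) (L : Type u) [AddCommGroup L] [Module K L] (f g : F.obj X →ₗ[K] L),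
      (∀ i, f ∘ₗ ((t i).app X).hom = g ∘ₗ ((t i).app X).hom) → f = g) :
    RelHopfModule K H D :=
  have nat (i : ι) {X Y : D} (f : X ⟶ Y) (m : (N i).F.obj X) :
      (F.map f).hom (((t i).app X).hom m) = ((t i).app Y).hom (((N i).F.map f).hom m) :=
    (LinearMap.congr_fun (congrArg ModuleCat.Hom.hom ((t i).naturality f)) m).symm
  have colin (i : ι) (X : D) (m : (N i).F.obj X) : RightComodule.ρ (H := H)
      (((t i).app X).hom m) = ((t i).app X).hom.rTensor H (RightComodule.ρ m) :=
    (LinearMap.congr_fun (ht i X) m).symm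
  -- The ambient functor category contains non-linear functors, so linearity has to be inherited
  -- from the `N i`.
  have add : F.Additive := ⟨fun {X Y f g} => by
    ext1
    refine h _ _ _ _ fun i => LinearMap.ext fun m => ?_
    simp only [LinearMap.comp_apply, nat, Functor.map_add, ModuleCat.hom_add,
      LinearMap.add_apply, map_add]⟩
  have lin : F.Linear K := ⟨fun {X Y} f r => by
    ext1
    refine h _ _ _ _ fun i => LinearMap.ext fun m => ?_
    simp only [LinearMap.comp_apply, nat, Functor.map_smul, ModuleCat.hom_smul,
      LinearMap.smul_apply, map_smul]⟩
  { F := F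
    additive := add
    linear := lin
    comod := inferInstance
    -- For fixed `f` both sides are linear in the element, so they can be compared on the jointly
    -- epimorphic family.
    ρ_map {X Y} f := LinearMap.congr_fun (f := RightComodule.ρ ∘ₗ (F.map f).hom)
        (g := pairH H (moduleAction F X Y) (RightComodule.ρ f) ∘ₗ RightComodule.ρ) <| by
      refine h _ _ _ _ fun i => LinearMap.ext fun m => ?_
      simp only [LinearMap.comp_apply]
      rw [nat, colin, colin, (N i).ρ_map]
      have := rTensor_pairH_of_comp (H := H) (moduleAction (N i).F X Y) (moduleAction F X Y)
        LinearMap.id ((t i).app X).hom ((t i).app Y).hom (fun a b => (nat i a b).symm)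
        (RightComodule.ρ f) (RightComodule.ρ m)
      rwa [LinearMap.rTensor_id, LinearMap.id_apply] at this }

/-- A functor with coactions which has a jointly injective family of colinear natural
transformations to relative Hopf modules is a relative Hopf module. -/
abbrev ofJointlyInjective (t : ∀ i, F ⟶ (N i).F)
    (ht : ∀ i X, ((t i).app X).hom.rTensor H ∘ₗ RightComodule.ρ =
      RightComodule.ρ ∘ₗ ((t i).app X).hom)
    (h : ∀ (X : D) (x y : F.obj X),
      (∀ i, ((t i).app X).hom x = ((t i).app X).hom y) → x = y)
    (h' : ∀ (X : D) (x y : F.obj X ⊗[K] H),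
      (∀ i, ((t i).app X).hom.rTensor H x = ((t i).app X).hom.rTensor H y) → x = y) :
    RelHopfModule K H D :=
  have nat (i : ι) {X Y : D} (f : X ⟶ Y) (m : F.obj X) :
      ((t i).app Y).hom ((F.map f).hom m) = ((N i).F.map f).hom (((t i).app X).hom m) :=
    LinearMap.congr_fun (congrArg ModuleCat.Hom.hom ((t i).naturality f)) m
  have colin (i : ι) (X : D) (m : F.obj X) : ((t i).app X).hom.rTensor H (RightComodule.ρ m) =
      RightComodule.ρ (H := H) (((t i).app X).hom m) :=
    LinearMap.congr_fun (ht i X) m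
  have add : F.Additive := ⟨fun {X Y f g} => by
    ext m
    refine h _ _ _ fun i => ?_
    simp [nat]⟩
  have lin : F.Linear K := ⟨fun {X Y} f r => by
    ext m
    refine h _ _ _ fun i => ?_
    simp [nat]⟩
  { F := F
    additive := add
    linear := lin
    comod := inferInstance
    ρ_map {X Y} f m := by
      refine h' _ _ _ fun i => ?_
      have := rTensor_pairH_of_comp (H := H) (moduleAction F X Y) (moduleAction (N i).F X Y)
        LinearMap.id ((t i).app X).hom ((t i).app Y).hom (fun a b => nat i a b)
        (RightComodule.ρ f) (RightComodule.ρ m)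
      rw [colin, nat, (N i).ρ_map, this, colin, LinearMap.rTensor_id, LinearMap.id_apply] }

end

section colimits

variable {J : Type*} [Category* J] {G : J ⥤ RelHopfModule K H D}

/-- Evaluation at each object preserves colimits, so the coactions are built objectwise and each
induced natural transformation is checked to be colinear objectwise. -/
theorem nonempty_liftsToColimit (c : Cocone (G ⋙ forget K H D)) (hc : IsColimit c) :
    Nonempty (LiftsToColimit G (forget K H D) c hc) := by
  let E (X : D) := (evaluation D (ModuleCat.{u} K)).obj X
  have hX (X : D) := isColimitOfPreserves (E X) hc
  let _ (j : J) (X : D) : RightComodule K H (((G ⋙ forget K H D) ⋙ E X).obj j) :=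
    (G.obj j).comod X
  choose comod hcomod using fun X : D => RightComodule.exists_comodule_of_isColimit (H := H)
    (hX X) (fun f => rTensor_comp_ρ (G.map f) X)
  let _ (X : D) : RightComodule K H (c.pt.obj X) := comod X
  let M : RelHopfModule K H D := ofJointlyEpi G.obj c.pt (fun j => c.ι.app j)
    (fun j X => hcomod X j) (fun X L _ _ f g h => RightComodule.linearMap_ext_of_isColimit (hX X) h)
  let c' : Cocone G :=
    { pt := M
      ι :=
        { app j := ⟨c.ι.app j, fun X m => (LinearMap.congr_fun (hcomod X j) m).symm⟩
          naturality i j f := hom_ext (c.ι.naturality f) } }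
  exact
   ⟨{ liftedCocone := c'
      validLift := Cocone.ext (Iso.refl _)
      makesColimit :=
        { desc s := ⟨hc.desc ((forget K H D).mapCocone s), fun X m => by
            let d : c.pt.obj X →ₗ[K] s.pt.F.obj X :=
              ((hc.desc ((forget K H D).mapCocone s)).app X).hom
            have h₁ (j : J) : d ∘ₗ RightComodule.leg ((E X).mapCocone c) j =
                ((s.ι.app j).nat.app X).hom :=
              congrArg (fun t : (G.obj j).F ⟶ s.pt.F => (t.app X).hom)
                (hc.fac ((forget K H D).mapCocone s) j)
            suffices h : RightComodule.ρ ∘ₗ d = d.rTensor H ∘ₗ RightComodule.ρ from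
              LinearMap.congr_fun h m
            exact RightComodule.linearMap_ext_of_isColimit (hX X) fun j =>
              RightComodule.ρ_comp_of_colinear (h₁ j) (hcomod X j) (rTensor_comp_ρ (s.ι.app j) X)⟩
          fac s j := hom_ext (hc.fac ((forget K H D).mapCocone s) j)
          uniq s f hf := hom_ext (hc.uniq ((forget K H D).mapCocone s) f.nat
            fun j => congrArg Hom.nat (hf j)) } }⟩

noncomputable instance : CreatesColimitsOfShape J (forget K H D) where
  CreatesColimit := createsColimitOfReflectsIso fun c hc => (nonempty_liftsToColimit c hc).some

end colimits

section limits

variable {J : Type} [SmallCategory J] [FinCategory J] {G : J ⥤ RelHopfModule K H D}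

theorem nonempty_liftsToLimit (c : Cone (G ⋙ forget K H D)) (hc : IsLimit c) :
    Nonempty (LiftsToLimit G (forget K H D) c hc) := by
  let E (X : D) := (evaluation D (ModuleCat.{u} K)).obj X
  have hX (X : D) := isLimitOfPreserves (E X) hc
  let _ (j : J) (X : D) : RightComodule K H (((G ⋙ forget K H D) ⋙ E X).obj j) :=
    (G.obj j).comod X
  choose comod hcomod using fun X : D => RightComodule.exists_comodule_of_isLimit (H := H)
    (hX X) (fun f => rTensor_comp_ρ (G.map f) X)
  let _ (X : D) : RightComodule K H (c.pt.obj X) := comod X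
  let M : RelHopfModule K H D := ofJointlyInjective G.obj c.pt (fun j => c.π.app j)
    (fun j X => hcomod X j) (fun X x y h => Concrete.isLimit_ext _ (hX X) x y h)
    (fun X x y h => RightComodule.tensor_ext_of_isLimit (hX X) H h)
  let c' : Cone G :=
    { pt := M
      π :=
        { app j := ⟨c.π.app j, fun X m => (LinearMap.congr_fun (hcomod X j) m).symm⟩
          naturality i j f := hom_ext (c.π.naturality f) } }
  exact
   ⟨{ liftedCone := c'
      validLift := Cone.ext (Iso.refl _)
      makesLimit :=
        { lift s := ⟨hc.lift ((forget K H D).mapCone s), fun X m => by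
            let d : s.pt.F.obj X →ₗ[K] c.pt.obj X :=
              ((hc.lift ((forget K H D).mapCone s)).app X).hom
            have h₁ (j : J) : RightComodule.proj ((E X).mapCone c) j ∘ₗ d =
                ((s.π.app j).nat.app X).hom :=
              congrArg (fun t : s.pt.F ⟶ (G.obj j).F => (t.app X).hom)
                (hc.fac ((forget K H D).mapCone s) j)
            exact RightComodule.tensor_ext_of_isLimit (hX X) H fun j =>
              RightComodule.rTensor_comp_of_colinear (h₁ j) (hcomod X j)
                (rTensor_comp_ρ (s.π.app j) X) m⟩
          fac s j := hom_ext (hc.fac ((forget K H D).mapCone s) j)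
          uniq s f hf := hom_ext (hc.uniq ((forget K H D).mapCone s) f.nat
            fun j => congrArg Hom.nat (hf j)) } }⟩

noncomputable instance : CreatesLimitsOfShape J (forget K H D) where
  CreatesLimit := createsLimitOfReflectsIso fun c hc => (nonempty_liftsToLimit c hc).some

end limits

/-! ### Abelianness and exact filtered colimits -/

instance : HasColimitsOfSize.{u, u} (RelHopfModule K H D) where
  has_colimits_of_shape _ _ :=
    hasColimitsOfShape_of_hasColimitsOfShape_createsColimitsOfShape (forget K H D)

instance : HasFiniteLimits (RelHopfModule K H D) where
  out _ _ _ := hasLimitsOfShape_of_hasLimitsOfShape_createsLimitsOfShape (forget K H D)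

instance : HasFiniteColimits (RelHopfModule K H D) where
  out _ _ _ := hasColimitsOfShape_of_hasColimitsOfShape_createsColimitsOfShape (forget K H D)

instance : PreservesFiniteLimits (forget K H D) where
  preservesFiniteLimits _ _ _ := inferInstance

instance : PreservesFiniteColimits (forget K H D) where
  preservesFiniteColimits _ _ _ := inferInstance

/-- `forget` is exact, so it sends the comparison map to the one in an abelian category, which is
invertible; it also reflects isomorphisms. -/
instance {M N : RelHopfModule K H D} (f : M ⟶ N) : IsIso (Abelian.coimageImageComparison f) :=
  have := IsIso.of_isIso_fac_right
    (Abelian.PreservesCoimage.hom_coimageImageComparison (forget K H D) f).symm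
  isIso_of_reflects_iso _ (forget K H D)

/-- The category of relative Hopf modules is abelian. -/
noncomputable abbrev abelian : Abelian (RelHopfModule K H D) :=
  Abelian.ofCoimageImageComparisonIsIso

instance : HasFilteredColimitsOfSize.{u, u} (RelHopfModule K H D) where
  HasColimitsOfShape _ _ _ := inferInstance

instance : AB5OfSize.{u, u} (RelHopfModule K H D) where
  ofShape J _ _ := HasExactColimitsOfShape.domain_of_functor J (forget K H D)

end RelHopfModule

/-! ### Generators -/

namespace RelHopfModule

open Limits

variable {K H D : Type u} [Field K] [Ring H] [HopfAlgebra K H]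
  [SmallCategory D] [Preadditive D] [Linear K D] [CoHCategory K H D]

section generators

variable {W : Type u} [AddCommGroup W] [Module K W] [RightComodule K H W]

/-- The morphism `Hom_D(X, -) ⊗ W ⟶ N`, `f ⊗ w ↦ N(f)(φ(w))`, attached to a colinear map
`φ : W → N(X)`. -/
noncomputable def ofColinear (N : RelHopfModule K H D) (X : D) (φ : W →ₗ[K] N.F.obj X)
    (hφ : ∀ w, RightComodule.ρ (H := H) (φ w) = φ.rTensor H (RightComodule.ρ w)) :
    (representable K H X).tensor W ⟶ N where
  nat :=
    { app Y := ModuleCat.ofHom (TensorProduct.lift ((moduleAction N.F X Y).compl₂ φ))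
      naturality Y Z f := by
        ext1
        refine TensorProduct.ext' fun g w => ?_
        exact LinearMap.congr_fun (congrArg ModuleCat.Hom.hom (N.F.map_comp (X := X) g f)) (φ w) }
  colinear Y m := by
    suffices h : RightComodule.ρ (H := H) ∘ₗ
        TensorProduct.lift ((moduleAction N.F X Y).compl₂ φ) =
        (TensorProduct.lift ((moduleAction N.F X Y).compl₂ φ)).rTensor H ∘ₗ
          (RightComodule.tensor K H (X ⟶ Y) W).ρ from LinearMap.congr_fun h m
    refine TensorProduct.ext' fun g w => ?_
    -- Compatibility in `N` expands the coaction of `N(g)(φ w)`; colinearity of `φ` turns it into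
    -- the tensor coaction of `g ⊗ w`.
    refine (N.ρ_map (X := X) g (φ w)).trans ?_
    rw [hφ, ← pairH_compl₂]
    exact (rTensor_lift_pairH_mk _ _ _).symm

theorem isSeparating_isStandardGenerator :
    ObjectProperty.IsSeparating (IsStandardGenerator (K := K) (H := H) (D := D)) := by
  intro M N f g h
  ext X m
  obtain ⟨P, hm, _, _, hP⟩ :=
    RightComodule.exists_finiteDimensional_subcomodule (K := K) (H := H) m
  -- The morphism attached to the inclusion of `P` sends `𝟙 X ⊗ m` to `m`.
  have e := h _ (.mk X P) (ofColinear M X P.subtype hP)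
  have e' := congrArg (fun t : (representable K H X).tensor P ⟶ N =>
    (t.nat.app X).hom (𝟙 X ⊗ₜ[K] (⟨m, hm⟩ : P))) e
  have e'' : (f.nat.app X).hom ((M.F.map (𝟙 X)).hom m) =
      (g.nat.app X).hom ((M.F.map (𝟙 X)).hom m) := e'
  simpa using e''

variable {W' : Type u} [AddCommGroup W'] [Module K W'] [RightComodule K H W']

/-- The morphism `N ⊗ W ⟶ N ⊗ W'` induced by a colinear map `W → W'`. -/
noncomputable def tensorMap (N : RelHopfModule K H D) (φ : W →ₗ[K] W')
    (hφ : ∀ w, RightComodule.ρ (H := H) (φ w) = φ.rTensor H (RightComodule.ρ w)) :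
    N.tensor W ⟶ N.tensor W' where
  nat :=
    { app Y := ModuleCat.ofHom (φ.lTensor (N.F.obj Y))
      naturality Y Z f := by
        ext1
        exact TensorProduct.ext' fun n w => rfl }
  colinear Y m := by
    suffices h : (RightComodule.tensor K H (N.F.obj Y) W').ρ ∘ₗ φ.lTensor (N.F.obj Y) =
        (φ.lTensor (N.F.obj Y)).rTensor H ∘ₗ (RightComodule.tensor K H (N.F.obj Y) W).ρ from
      LinearMap.congr_fun h m
    refine TensorProduct.ext' fun n w => ?_
    have h := rTensor_pairH_of_comp (H := H) (TensorProduct.mk K (N.F.obj Y) W)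
      (TensorProduct.mk K (N.F.obj Y) W') LinearMap.id φ (φ.lTensor (N.F.obj Y))
      (fun _ _ => rfl) (RightComodule.ρ n) (RightComodule.ρ w)
    rw [LinearMap.rTensor_id, LinearMap.id_apply, ← hφ] at h
    exact h.symm

/-- The isomorphism `N ⊗ W ≅ N ⊗ W'` induced by a colinear isomorphism `W ≃ W'`. -/
noncomputable def tensorIso (N : RelHopfModule K H D) (e : W ≃ₗ[K] W')
    (h : ∀ w, RightComodule.ρ (H := H) (e w) = e.toLinearMap.rTensor H (RightComodule.ρ w)) :
    N.tensor W ≅ N.tensor W' where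
  hom := tensorMap N e.toLinearMap h
  inv := tensorMap N e.symm.toLinearMap fun w => by
    obtain ⟨w, rfl⟩ := e.surjective w
    simp only [LinearEquiv.coe_coe, LinearEquiv.symm_apply_apply, h]
    rw [← LinearMap.comp_apply, ← LinearMap.rTensor_comp, LinearEquiv.symm_comp,
      LinearMap.rTensor_id, LinearMap.id_apply]
  hom_inv_id := by
    ext Y : 4
    exact (LinearMap.lTensor_comp (N.F.obj Y) _ _).symm.trans (by simp; rfl)
  inv_hom_id := by
    ext Y : 4
    exact (LinearMap.lTensor_comp (N.F.obj Y) _ _).symm.trans (by simp; rfl)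

end generators

/-- The modules `Hom_D(X, -) ⊗ Kⁿ` for all comodule structures on the spaces `Kⁿ`. -/
noncomputable def coordinateGenerator
    (i : D × Σ n : ℕ, RightComodule K H (Fin n → K)) : RelHopfModule K H D :=
  let _ := i.2.2
  (representable K H i.1).tensor (Fin i.2.1 → K)

/-- A basis of `W` transports its coaction to `Kⁿ`, and the coactions on the spaces `Kⁿ` form a type
in the universe `u`. -/
theorem isStandardGenerator_le_isoClosure : IsStandardGenerator (K := K) (H := H) (D := D) ≤
    (ObjectProperty.ofObj coordinateGenerator).isoClosure := by
  rintro _ ⟨X, W⟩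
  let e : W ≃ₗ[K] (Fin (Module.finrank K W) → K) := (Module.finBasis K W).equivFun
  let σ := e.toLinearMap.rTensor H ∘ₗ RightComodule.ρ ∘ₗ e.symm.toLinearMap
  let c : RightComodule K H (Fin (Module.finrank K W) → K) :=
    RightComodule.ofInjective e.symm.toLinearMap e.symm.injective σ <| by
      rw [← LinearMap.comp_assoc, ← LinearMap.rTensor_comp, LinearEquiv.symm_comp,
        LinearMap.rTensor_id, LinearMap.id_comp]
  refine ⟨_, ObjectProperty.ofObj_apply coordinateGenerator ⟨X, _, c⟩,
    ⟨tensorIso (representable K H X) e fun w => ?_⟩⟩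
  change e.toLinearMap.rTensor H (RightComodule.ρ (e.symm (e w))) = _
  rw [e.symm_apply_apply]

theorem essentiallySmall_isStandardGenerator :
    ObjectProperty.EssentiallySmall.{u} (IsStandardGenerator (K := K) (H := H) (D := D)) :=
  ⟨_, inferInstance, isStandardGenerator_le_isoClosure⟩

theorem isSeparator_sigma_coordinateGenerator :
    IsSeparator (∐ coordinateGenerator (K := K) (H := H) (D := D)) := by
  refine ObjectProperty.IsSeparating.isSeparator_coproduct fun M N f g h => ?_
  refine isSeparating_isStandardGenerator f g fun G hG t => ?_
  obtain ⟨G', hG', ⟨e⟩⟩ := isStandardGenerator_le_isoClosure _ hG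
  -- The separating property passes from the standard generators to their coordinate copies along
  -- `e`.
  rw [← cancel_epi e.inv, ← Category.assoc, ← Category.assoc]
  exact h G' hG' (e.inv ≫ t)

end RelHopfModule

theorem mainTheorem7 (K H D : Type u) [Field K] [Ring H] [HopfAlgebra K H]
    [SmallCategory D] [Preadditive D] [Linear K D] [CoHCategory K H D] :
    (∃ abelian : Abelian (RelHopfModule K H D),
      abelian.toPreadditive = RelHopfModule.instPreadditive ∧
      IsGrothendieckAbelian.{u} (RelHopfModule K H D)) ∧
    ObjectProperty.EssentiallySmall.{u}
      (RelHopfModule.IsStandardGenerator (K := K) (H := H) (D := D)) ∧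
    ObjectProperty.IsSeparating
      (RelHopfModule.IsStandardGenerator (K := K) (H := H) (D := D)) := by
  -- `rfl` holds because the abelian structure is built on the pointwise addition itself.
  refine ⟨⟨RelHopfModule.abelian, rfl, ?_⟩, RelHopfModule.essentiallySmall_isStandardGenerator,
    RelHopfModule.isSeparating_isStandardGenerator⟩
  let _ : Abelian (RelHopfModule K H D) := RelHopfModule.abelian
  exact
    { hasSeparator := ⟨_, RelHopfModule.isSeparator_sigma_coordinateGenerator⟩ }
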